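/- Let $\mathbb{N}=\{1,2,3,\dots\}$ and $\omega=\mathbb{N}\cup\{0\}$. A \emph{family} on $\mathbb{N}$ is a nonempty collection $\mathcal{F}$ of nonempty subsets of $\mathbb{N}$ such that $A\in\mathcal{F}$ and $A\subseteq B\subseteq\mathbb{N}$ imply $B\in\mathcal{F}$. It has the \emph{Ramsey property} if $A\in\mathcal{F}$ and $A=A_1\cup A_2$ imply $A_1\in\mathcal{F}$ or $A_2\in\mathcal{F}$. It is \emph{shift invariant} if $s+E=\{s+t:t\in E\}\in\mathcal{F}$, and \emph{inverse shift invariant} if $-s+E=\{t\in\mathbb{N}:s+t\in E\}\in\mathcal{F}$, for all $s\in\mathbb{N}$ and $E\in\mathcal{F}$. For a discrete set $S$ let $\beta S$ be its Stone–Čech compactification, the space of ultrafilters on $S$, and put $\beta(\mathcal{F})=\{p\in\beta\mathbb{N}:p\subseteq\mathcal{F}\}$; regard $\beta\mathbb{N}$ as a subset of $\beta\omega$ in the usual way. For real $\alpha>0$ and $0<\gamma<1$ define $g_{\alpha,\gamma}:\mathbb{N}\to\omega$ by $g_{\alpha,\gamma}(n)=\lfloor\alpha n+\gamma\rfloor$,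 let $\widetilde{g_{\alpha,\gamma}}:\beta\mathbb{N}\to\beta\omega$ be its continuous extension, and write $g_{\alpha,\gamma}[\mathcal{F}]\subseteq\mathcal{F}$ if $g_{\alpha,\gamma}[E]\cap\mathbb{N}\in\mathcal{F}$ for every $E\in\mathcal{F}$. \textbf{Theorem.} Let $\mathcal{F}$ be a shift invariant and inverse shift invariant family on $\mathbb{N}$ with the Ramsey property such that $g_{a,c}[\mathcal{F}]\subseteq\mathcal{F}$ for all real $a>0$ and $0<c<1$. Let $0<\alpha\le 1$ and $0<\gamma<1$. Then $$\widetilde{g_{\alpha,\gamma}}\left[\beta(\mathcal{F})\right]=\beta(\mathcal{F}).$$ -/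

import Mathlib

namespace SpectraFamilies

/-- A family on `S`: a nonempty upward hereditary collection of nonempty subsets of `S`. -/
structure IsFamily {S : Type*} (F : Set (Set S)) : Prop where
  nonempty : F.Nonempty
  empty_notMem : ∅ ∉ F
  upward : ∀ A B : Set S, A ∈ F → A ⊆ B → B ∈ F

/-- The Ramsey property (partition regularity). -/
def HasRamseyProperty {S : Type*} (F : Set (Set S)) : Prop :=
  ∀ A A₁ A₂ : Set S, A ∈ F → A = A₁ ∪ A₂ → A₁ ∈ F ∨ A₂ ∈ F

/-- `s + E ∈ F` for all `s ∈ S` and all `E ∈ F`. -/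
def IsShiftInvariant {S : Type*} [Add S] (F : Set (Set S)) : Prop :=
  ∀ (s : S) (E : Set S), E ∈ F → (fun t => s + t) '' E ∈ F

/-- `-s + E = {t ∈ S | s + t ∈ E} ∈ F` for all `s ∈ S` and all `E ∈ F`. -/
def IsInverseShiftInvariant {S : Type*} [Add S] (F : Set (Set S)) : Prop :=
  ∀ (s : S) (E : Set S), E ∈ F → {t : S | s + t ∈ E} ∈ F

/-- `β(F) = {p ∈ βS : p ⊆ F}`, where `βS` is the space of ultrafilters on the discrete set `S`. -/
def beta {S : Type*} (F : Set (Set S)) : Set (Ultrafilter S) :=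
  {p | ∀ A : Set S, A ∈ p → A ∈ F}

/-- The nonhomogeneous spectrum map `n ↦ ⌊α n + γ⌋` on the positive integers. For small `α` it
takes the value `0` at finitely many points, so its codomain is the set of nonnegative integers. -/
noncomputable def g (α γ : ℝ) (n : ℕ+) : ℕ := ⌊α * (n : ℝ) + γ⌋₊

/-- The continuous extension of `g α γ` to the Stone–Čech compactifications. -/
noncomputable def gExt (α γ : ℝ) : Ultrafilter ℕ+ → Ultrafilter ℕ :=
  Ultrafilter.extend fun n => (pure (g α γ n) : Ultrafilter ℕ)

/-- The canonical embedding of the compactification of the positive integers into that of the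
nonnegative integers; its range is the set of ultrafilters having the positive integers as a
member. -/
def inclExt (p : Ultrafilter ℕ+) : Ultrafilter ℕ := p.map fun n : ℕ+ => (n : ℕ)

/-- `g_{α,γ}[F] ⊆ F`: for each `E ∈ F`, the set of positive integers lying in the image of `E`
under `g α γ` belongs to `F`. -/
def SpectrumPreserves (α γ : ℝ) (F : Set (Set ℕ+)) : Prop :=
  ∀ E : Set ℕ+, E ∈ F → {m : ℕ+ | (m : ℕ) ∈ g α γ '' E} ∈ F

/-- The extension is the push-forward of ultrafilters: `A ∈ gExt α γ p ↔ (g α γ)⁻¹ A ∈ p`. -/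
theorem gExt_eq_map (α γ : ℝ) (p : Ultrafilter ℕ+) : gExt α γ p = p.map (g α γ) := by
  unfold gExt
  rw [ultrafilter_extend_eq_iff, ultrafilter_converges_iff]
  ext s
  rfl

end SpectraFamilies

namespace SpectraFamilies

/-! The extension is push-forward of ultrafilters. If `p ⊆ F` and `A` lies in its image, the
preimage of `A` is in `F`, and applying `g α γ` to it stays inside `A`, so `A ∈ F`. Conversely, for
`q ⊆ F` the preimages of members of `q` lie in `F`, since `g α γ` has a right inverse of the form `g
(1 / α) c` (`preimage_g_mem`). The Ramsey property then refines the filter they generate to some `p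
⊆ F` (`exists_ultrafilter_mem_beta`), which maps to `q`. -/

/-- The filter of sets whose complement is not a member of a family with the Ramsey property. -/
def dualFilter {S : Type*} (F : Set (Set S)) (hF : IsFamily F) (hR : HasRamseyProperty F) :
    Filter S where
  sets := {B | Bᶜ ∉ F}
  univ_sets := by simpa using hF.empty_notMem
  sets_of_superset := fun hA hAB hB => hA (hF.upward _ _ hB (Set.compl_subset_compl.2 hAB))
  inter_sets := fun hA hB h => (hR _ _ _ h (Set.compl_inter _ _)).elim hA hB

theorem mem_dualFilter {S : Type*} {F : Set (Set S)} {hF : IsFamily F}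
    {hR : HasRamseyProperty F} {B : Set S} : B ∈ dualFilter F hF hR ↔ Bᶜ ∉ F :=
  Iff.rfl

/-- A filter all of whose members lie in a family with the Ramsey property extends to an
ultrafilter with the same property. -/
theorem exists_ultrafilter_mem_beta {S : Type*} {F : Set (Set S)} (hF : IsFamily F)
    (hR : HasRamseyProperty F) (l : Filter S) (hl : ∀ A ∈ l, A ∈ F) :
    ∃ p ∈ beta F, (p : Filter S) ≤ l := by
  have hne : (l ⊓ dualFilter F hF hR).NeBot := by
    rw [Filter.inf_neBot_iff]
    intro A hA B hB
    by_contra hAB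
    rw [Set.not_nonempty_iff_eq_empty, ← Set.disjoint_iff_inter_eq_empty] at hAB
    exact mem_dualFilter.1 hB (hF.upward _ _ (hl A hA) hAB.subset_compl_right)
  refine ⟨Ultrafilter.of (l ⊓ dualFilter F hF hR), fun A hA => ?_,
    (Ultrafilter.of_le _).trans inf_le_left⟩
  by_contra hAF
  have hAc : Aᶜ ∈ Ultrafilter.of (l ⊓ dualFilter F hF hR) :=
    ((Ultrafilter.of_le _).trans inf_le_right) (mem_dualFilter.2 (by rwa [compl_compl]))
  exact Ultrafilter.compl_mem_iff_notMem.1 hAc hA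

/-- An inverse shift invariant family contains no bounded set. -/
theorem notMem_of_forall_le {F : Set (Set ℕ+)} (hF : IsFamily F)
    (hinv : IsInverseShiftInvariant F) {E : Set ℕ+} (N : ℕ+) (hE : ∀ n ∈ E, n ≤ N) : E ∉ F := by
  intro h
  refine hF.empty_notMem ?_
  convert hinv N E h
  symm
  rw [Set.eq_empty_iff_forall_notMem]
  intro t ht
  exact absurd (hE _ ht) (not_le.2 (PNat.lt_add_right N t))

theorem one_le_g {α γ : ℝ} (hα : 0 < α) (hγ : 0 < γ) {n : ℕ+} (hn : 1 / α ≤ (n : ℝ)) :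
    1 ≤ g α γ n := by
  unfold g
  rw [Nat.one_le_floor_iff]
  rw [div_le_iff₀ hα] at hn
  linarith

theorem range_inclExt_of_mem {q : Ultrafilter ℕ} (hq : {m : ℕ | 0 < m} ∈ q) :
    ∃ p : Ultrafilter ℕ+, inclExt p = q := by
  have hr : Set.range (fun n : ℕ+ => (n : ℕ)) ∈ q :=
    Filter.mem_of_superset hq fun m hm => ⟨⟨m, hm⟩, rfl⟩
  refine ⟨q.comap PNat.coe_injective hr, ?_⟩
  apply Ultrafilter.coe_injective
  rw [inclExt, Ultrafilter.coe_map, Ultrafilter.coe_comap, Filter.map_comap_of_mem hr]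

theorem g_one {γ : ℝ} (hγ₀ : 0 < γ) (hγ₁ : γ < 1) (n : ℕ+) : g 1 γ n = n := by
  unfold g
  rw [Nat.floor_eq_iff (by positivity)]
  constructor <;> linarith

/-- For `α < 1`, some `g_{1/α,c}` is a right inverse of `g_{α,γ}`. -/
theorem exists_g_rightInverse {α γ : ℝ} (hα₀ : 0 < α) (hα₁ : α < 1) (hγ₀ : 0 < γ) (hγ₁ : γ < 1) :
    ∃ c : ℝ, 0 < c ∧ c < 1 ∧ ∀ m n : ℕ+, (n : ℕ) = g (1 / α) c m → g α γ n = m := by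
  -- Here `d = α * c`. From `α * n ≤ m + d < α * n + α`, the bounds `α - γ < d < 1 - γ` put `α * n +
  -- γ` in `[m, m + 1)`; `0 < d < α` gives `0 < c < 1`.
  obtain ⟨d, hd₁, hd₂⟩ : ∃ d, max 0 (α - γ) < d ∧ d < min α (1 - γ) := by
    apply exists_between
    rw [max_lt_iff, lt_min_iff, lt_min_iff]
    refine ⟨⟨?_, ?_⟩, ?_, ?_⟩ <;> linarith
  rw [max_lt_iff] at hd₁
  rw [lt_min_iff] at hd₂
  refine ⟨d / α, div_pos hd₁.1 hα₀, (div_lt_one hα₀).2 hd₂.1, fun m n hn => ?_⟩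
  have hd₀ := hd₁.1
  have hpos : 0 ≤ 1 / α * (m : ℝ) + d / α := by positivity
  obtain ⟨h₁, h₂⟩ := (Nat.floor_eq_iff hpos).1 hn.symm
  have e : 1 / α * (m : ℝ) + d / α = (m + d) / α := by ring
  rw [e, le_div_iff₀ hα₀] at h₁
  rw [e, div_lt_iff₀ hα₀] at h₂
  unfold g
  rw [Nat.floor_eq_iff (by positivity)]
  constructor <;> linarith

/-- Preimages under `g_{α,γ}` of members of the family are members of the family. -/
theorem preimage_g_mem {α γ : ℝ} (hα₀ : 0 < α) (hα₁ : α ≤ 1) (hγ₀ : 0 < γ) (hγ₁ : γ < 1)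
    {F : Set (Set ℕ+)} (hF : IsFamily F)
    (hg : ∀ a c : ℝ, 0 < a → 0 < c → c < 1 → SpectrumPreserves a c F) {E : Set ℕ+} (hE : E ∈ F) :
    g α γ ⁻¹' ((fun n : ℕ+ => (n : ℕ)) '' E) ∈ F := by
  -- At `α = 1` the interval for `d` is empty, but `g` is the identity.
  rcases hα₁.eq_or_lt with rfl | hα₁
  · exact hF.upward _ _ hE fun n hn => ⟨n, hn, (g_one hγ₀ hγ₁ n).symm⟩
  · obtain ⟨c, hc₀, hc₁, hc⟩ := exists_g_rightInverse hα₀ hα₁ hγ₀ hγ₁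
    refine hF.upward _ _ (hg (1 / α) c (by positivity) hc₀ hc₁ E hE) ?_
    rintro n ⟨m, hm, hmn⟩
    exact ⟨m, hm, (hc m n hmn.symm).symm⟩

/-- The value `0` occurs only for `n < 1 / α`, a bounded set, hence not in `p`. So the image of `p`
comes from an ultrafilter on `ℕ+`. -/
theorem pos_mem_gExt {α γ : ℝ} (hα : 0 < α) (hγ : 0 < γ) {F : Set (Set ℕ+)} (hF : IsFamily F)
    (hinv : IsInverseShiftInvariant F) {p : Ultrafilter ℕ+} (hp : p ∈ beta F) :
    {m : ℕ | 0 < m} ∈ gExt α γ p := by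
  rw [gExt_eq_map, Ultrafilter.mem_map]
  by_contra h
  obtain ⟨N, hN⟩ := exists_nat_ge (1 / α)
  refine notMem_of_forall_le hF hinv N.succPNat (fun n hn => ?_)
    (hp _ (Ultrafilter.compl_mem_iff_notMem.2 h))
  by_contra hlt
  refine hn (one_le_g hα hγ (hN.trans ?_))
  have : N.succPNat < n := not_le.1 hlt
  have : N + 1 < (n : ℕ) := this
  exact_mod_cast (by omega : N ≤ (n : ℕ))

end SpectraFamilies

open SpectraFamilies in
theorem mainTheorem7 (α γ : ℝ) (hα₀ : 0 < α) (hα₁ : α ≤ 1) (hγ₀ : 0 < γ) (hγ₁ : γ < 1)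
    (F : Set (Set ℕ+))
    (hF : SpectraFamilies.IsFamily F)
    (hRamsey : SpectraFamilies.HasRamseyProperty F)
    (hshift : SpectraFamilies.IsShiftInvariant F)
    (hinv : SpectraFamilies.IsInverseShiftInvariant F)
    (hg : ∀ a c : ℝ, 0 < a → 0 < c → c < 1 → SpectraFamilies.SpectrumPreserves a c F) :
    SpectraFamilies.gExt α γ '' SpectraFamilies.beta F =
      SpectraFamilies.inclExt '' SpectraFamilies.beta F := by
  apply Set.Subset.antisymm
  · rintro _ ⟨p, hp, rfl⟩
    obtain ⟨q, hq⟩ := range_inclExt_of_mem (pos_mem_gExt hα₀ hγ₀ hF hinv hp)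
    refine ⟨q, fun A hA => ?_, hq⟩
    have hA' : (fun n : ℕ+ => (n : ℕ)) '' A ∈ gExt α γ p := by
      rw [← hq]
      exact Filter.image_mem_map hA
    rw [gExt_eq_map, Ultrafilter.mem_map] at hA'
    refine hF.upward _ _ (hg α γ hα₀ hγ₀ hγ₁ _ (hp _ hA')) ?_
    rintro m ⟨n, ⟨k, hk, hkn⟩, hnm⟩
    rwa [← PNat.coe_injective (hkn.trans hnm)]
  · rintro _ ⟨q, hq, rfl⟩
    obtain ⟨p, hp, hpq⟩ := exists_ultrafilter_mem_beta hF hRamsey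
      (Filter.comap (g α γ) (inclExt q : Filter ℕ)) (by
        rintro A ⟨B, hB, hBA⟩
        refine hF.upward _ _ (preimage_g_mem hα₀ hα₁ hγ₀ hγ₁ hF hg (hq _ hB))
          (Set.Subset.trans (Set.preimage_mono ?_) hBA)
        exact Set.image_preimage_subset _ _)
    refine ⟨p, hp, ?_⟩
    rw [gExt_eq_map]
    -- Comparable ultrafilters are equal, so one inequality suffices.
    exact Ultrafilter.coe_le_coe.1 (Filter.map_le_iff_le_comap.2 hpq)
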